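/- Let $G=(\mathcal V,\mathcal E)$ be a finite simple graph with $\mathcal V\neq\emptyset$, and let $\{\mathcal C_l\}_{l=1}^{k}$ be a clique cover of $G$, that is, a partition of $\mathcal V$ into nonempty cliques. For $v\in\mathcal V$ and $S\subseteq\mathcal V$ let $|e(v,S)|$ denote the number of neighbours of $v$ in $S$. Suppose that $G$ satisfies the $c$-sparse clique cover ($c$-SCC) property with respect to this cover, i.e. $$|e(v,\mathcal C_l)|\le c\,|\mathcal C_l|\qquad\text{for every vertex } v \text{ and every } l \text{ with } v\notin\mathcal C_l,$$ for some real number $$c<\min\left\{\frac14\left(\frac{\min_l 1/|\mathcal C_l|}{\sum_l 1/|\mathcal C_l|}\right)^2,\ \frac1{100}\right\}.$$ Consider the Lovász theta semidefinite program $$\min_{t\in\mathbb R,\ A\in\mathbb R^{\mathcal V\times\mathcal V}}\ \Big\{\,t\ :\ tI+A-J\succeq 0,\ A_{i,i}=0 \text{ for all } i,\ A_{i,j}=0\text{ for all }(i,j)\notin\mathcal E\,\Big\},$$ where $I$ is the identity matrix and $J$ the all-ones matrix. Put $$A^\star=\sum_{l=1}^{k}k\,\mathbf 1_{\mathcal C_l}\mathbf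 1_{\mathcal C_l}^T-kI,\qquad X^\star=kI+A^\star-J.$$ Then $(t,A)=(k,A^\star)$ is the unique optimal solution of this program; equivalently, $X^\star$ is the unique matrix of the form $X=tI+A-J$ with $(t,A)$ optimal. -/

import Mathlib

open scoped Matrix

/-- The family `C 0, …, C (k-1)` is a clique cover of `G`: a partition of the vertex set into
nonempty cliques. -/
structure IsCliqueCover {V : Type*} (G : SimpleGraph V) {k : ℕ} (C : Fin k → Finset V) : Prop where
  nonempty : ∀ l, (C l).Nonempty
  isClique : ∀ l, G.IsClique (C l : Set V)
  disjoint : ∀ l m, l ≠ m → Disjoint (C l) (C m)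
  cover : ∀ v, ∃ l, v ∈ C l

/-- The number `|e(v, S)|` of edges between the vertex `v` and the vertices of `S`. -/
def edgesInto {V : Type*} (G : SimpleGraph V) [DecidableRel G.Adj] (v : V) (S : Finset V) : ℕ :=
  (S.filter (fun w => G.Adj v w)).card

/-- The `c`-sparse clique cover property of `G` with respect to the family of cliques `C`. -/
def IsSCC {V : Type*} (G : SimpleGraph V) [DecidableRel G.Adj] {k : ℕ} (C : Fin k → Finset V)
    (c : ℝ) : Prop :=
  ∀ (v : V) (l : Fin k), v ∉ C l → (edgesInto G v (C l) : ℝ) ≤ c * ((C l).card : ℝ)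

/-- The all-ones matrix. -/
def allOnes (V : Type*) : Matrix V V ℝ := Matrix.of fun _ _ => 1

/-- The matrix `X = t I + A - J` attached to a pair `(t, A)`. -/
def slack {V : Type*} [DecidableEq V] (p : ℝ × Matrix V V ℝ) : Matrix V V ℝ :=
  p.1 • (1 : Matrix V V ℝ) + p.2 - allOnes V

/-- The feasible pairs `(t, A)` of the Lovász theta semidefinite program. -/
def thetaFeasible {V : Type*} [DecidableEq V] (G : SimpleGraph V) : Set (ℝ × Matrix V V ℝ) :=
  {p | (slack p).PosSemidef ∧ (∀ i, p.2 i i = 0) ∧ ∀ i j, ¬ G.Adj i j → p.2 i j = 0}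

/-- The optimal pairs `(t, A)`: the feasible pairs at which the objective `t` is minimal. -/
def thetaOptimal {V : Type*} [DecidableEq V] (G : SimpleGraph V) : Set (ℝ × Matrix V V ℝ) :=
  {p | p ∈ thetaFeasible G ∧ ∀ q ∈ thetaFeasible G, p.1 ≤ q.1}

/-- The indicator vector of a set of vertices. -/
def indVec {V : Type*} [DecidableEq V] (S : Finset V) : V → ℝ := fun v => if v ∈ S then 1 else 0

/-- `A⋆ = ∑ₗ k 1_{Cₗ} 1_{Cₗ}ᵀ - k I`. -/
noncomputable def Astar {V : Type*} [DecidableEq V] {k : ℕ} (C : Fin k → Finset V) :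
    Matrix V V ℝ :=
  ∑ l, (k : ℝ) • Matrix.vecMulVec (indVec (C l)) (indVec (C l)) - (k : ℝ) • (1 : Matrix V V ℝ)

/-- `X⋆ = k I + A⋆ - J`. -/
noncomputable def Xstar {V : Type*} [DecidableEq V] {k : ℕ} (C : Fin k → Finset V) :
    Matrix V V ℝ :=
  (k : ℝ) • (1 : Matrix V V ℝ) + Astar C - allOnes V

/-!
The clique solution `(k, A⋆)` is feasible because its slack matrix has the quadratic form
`k ∑ s_l² - (∑ s_l)²` in the sums `s_l` of a vector over the `k` cliques. Its optimality and
uniqueness come from a dual certificate `Z`, positive semidefinite and zero at the edges, which is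
used only through the linear functional `dualPairing : M ↦ ⟨M, Z⟩`.

If there were no edges between the cliques, `Z` could have diagonal blocks `I / |C_l|` and constant
off-diagonal blocks `1 / (|C_l| |C_m|)`. In general, the weight at each edge `(p, q)` between two
cliques is moved to the non-edges `(p, j)`, `(i, q)`, `(i, j)` with signs `+, +, -`, averaged over
all pairs `(i, j)` for which these three are non-edges. This preserves row and column sums, hence
`⟨I, Z⟩ = k`, `⟨J, Z⟩ = k²`, and `⟨A, Z⟩ = 0` for `A` supported on the edges
(`blockMean_eq_zero`), so `⟨X, Z⟩ = k (t - k)` for each feasible slack matrix `X`.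

On a rank-one matrix `y yᵀ` the correction is a sum of products `(y p - y i) (y q - y j)`, so it
depends only on the deviations of `y` from its clique means. Sparsity bounds it by
`3 c (var_l + var_m)` for each pair of cliques (`abs_rerouting_le`); since `c k ≤ 1 / 20`, the form
of `Z` is at least `(∑ mean_l)² + (1 / 2) ∑ var_l` (`dualPairing_vecMulVec_ge`). Writing `X` as a sum
of rank-one matrices gives `t ≥ k`, and if `t = k` then every one of them comes from a vector
constant on the cliques. Such an `X` is constant on blocks, and its diagonal together with one
non-edge in each off-diagonal block determines it (`eq_Astar`).
-/

open Finset

/-! ### The corrected block average -/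

/-- The pairs `(i, j) ∈ S × T` that can be used to reroute the edge `(p, q)`: the three pairs
`(p, j)`, `(i, q)` and `(i, j)` are all non-edges. -/
def reroutes {V : Type*} (G : SimpleGraph V) [DecidableRel G.Adj] (S T : Finset V) (p q : V) :
    Finset (V × V) :=
  {x ∈ S ×ˢ T | ¬ G.Adj p x.2 ∧ ¬ G.Adj x.1 q ∧ ¬ G.Adj x.1 x.2}

/-- The double difference `M p q - M p j - M i q + M i j`, as a linear functional of `M`. -/
def doubleDiff {V : Type*} (p q i j : V) : Matrix V V ℝ →ₗ[ℝ] ℝ :=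
  Matrix.entryLinearMap ℝ ℝ p q - Matrix.entryLinearMap ℝ ℝ p j
    - Matrix.entryLinearMap ℝ ℝ i q + Matrix.entryLinearMap ℝ ℝ i j

/-- The total over the edges `(p, q)` between `S` and `T` of the mean of the double differences
`M p q - M p j - M i q + M i j` over the rerouting pairs `(i, j)`. An edge without rerouting pairs
contributes `0`; sparsity excludes this (`card_le_two_mul_card_reroutes`). -/
noncomputable def rerouting {V : Type*} (G : SimpleGraph V) [DecidableRel G.Adj]
    (S T : Finset V) : Matrix V V ℝ →ₗ[ℝ] ℝ :=
  ∑ p ∈ S, ∑ q ∈ T with G.Adj p q,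
    ((#(reroutes G S T p q) : ℝ)⁻¹) • ∑ x ∈ reroutes G S T p q, doubleDiff p q x.1 x.2

/-- The mean of the entries of `M` over `S × T`, corrected so that it only involves entries at
non-edges if every edge has a rerouting pair: each entry at an edge is traded for entries at
non-edges without changing any of the row and column sums of the weights. -/
noncomputable def blockMean {V : Type*} (G : SimpleGraph V) [DecidableRel G.Adj]
    (S T : Finset V) : Matrix V V ℝ →ₗ[ℝ] ℝ :=
  ((#S * #T : ℝ)⁻¹) • (∑ p ∈ S, ∑ q ∈ T, Matrix.entryLinearMap ℝ ℝ p q - rerouting G S T)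

/-- The pairing `M ↦ ⟨M, Z⟩` with a feasible point `Z` of the dual program, scaled to have
trace `k`: the mean of the diagonal entries on the diagonal blocks and the corrected block mean
on the others. -/
noncomputable def dualPairing {V : Type*} (G : SimpleGraph V) [DecidableRel G.Adj] {k : ℕ}
    (C : Fin k → Finset V) : Matrix V V ℝ →ₗ[ℝ] ℝ :=
  ∑ l, ∑ m, if l = m then ((#(C l) : ℝ)⁻¹) • ∑ i ∈ C l, Matrix.entryLinearMap ℝ ℝ i i
    else blockMean G (C l) (C m)

/-- The mean of `y` over `S`. -/
noncomputable def meanOn {V : Type*} (S : Finset V) (y : V → ℝ) : ℝ := (#S : ℝ)⁻¹ * ∑ i ∈ S, y i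

/-- The variance of `y` over `S`, for the uniform distribution on `S`. -/
noncomputable def varOn {V : Type*} (S : Finset V) (y : V → ℝ) : ℝ :=
  (#S : ℝ)⁻¹ * ∑ i ∈ S, (y i - meanOn S y) ^ 2

section Block

variable {V : Type*} (G : SimpleGraph V) [DecidableRel G.Adj]

lemma doubleDiff_apply (p q i j : V) (M : Matrix V V ℝ) :
    doubleDiff p q i j M = M p q - M p j - M i q + M i j := by
  simp [doubleDiff]

lemma rerouting_apply (S T : Finset V) (M : Matrix V V ℝ) :
    rerouting G S T M = ∑ p ∈ S, ∑ q ∈ T with G.Adj p q, ((#(reroutes G S T p q) : ℝ)⁻¹) *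
      ∑ x ∈ reroutes G S T p q, (M p q - M p x.2 - M x.1 q + M x.1 x.2) := by
  simp [rerouting, doubleDiff_apply, LinearMap.sum_apply]

lemma blockMean_apply (S T : Finset V) (M : Matrix V V ℝ) :
    blockMean G S T M = (#S * #T : ℝ)⁻¹ * (∑ p ∈ S, ∑ q ∈ T, M p q - rerouting G S T M) := by
  simp [blockMean, LinearMap.sum_apply]

lemma varOn_nonneg (S : Finset V) (y : V → ℝ) : 0 ≤ varOn S y := by
  unfold varOn; positivity

lemma card_mul_varOn {S : Finset V} (hS : S.Nonempty) (y : V → ℝ) :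
    #S * varOn S y = ∑ i ∈ S, (y i - meanOn S y) ^ 2 := by
  have : (#S : ℝ) ≠ 0 := by simpa using hS.ne_empty
  unfold varOn; field_simp

lemma mean_sq_eq {S : Finset V} (hS : S.Nonempty) (y : V → ℝ) :
    (#S : ℝ)⁻¹ * ∑ i ∈ S, y i * y i = meanOn S y ^ 2 + varOn S y := by
  have h0 : (#S : ℝ) ≠ 0 := by simpa using hS.ne_empty
  have h1 : ∑ i ∈ S, y i = #S * meanOn S y := by unfold meanOn; field_simp
  have h2 : ∑ i ∈ S, (y i - meanOn S y) ^ 2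
      = ∑ i ∈ S, y i * y i - 2 * meanOn S y * ∑ i ∈ S, y i + #S * meanOn S y ^ 2 := by
    rw [mul_sum, ← sum_sub_distrib, ← nsmul_eq_mul, ← sum_const, ← sum_add_distrib]
    exact sum_congr rfl fun i _ => by ring
  rw [varOn, h2, h1]
  field_simp
  ring

lemma eq_meanOn_of_varOn_eq_zero {S : Finset V} {y : V → ℝ} (h : varOn S y = 0) {i : V}
    (hi : i ∈ S) : y i = meanOn S y := by
  have hs := card_mul_varOn ⟨i, hi⟩ y
  rw [h, mul_zero, eq_comm, sum_eq_zero_iff_of_nonneg fun _ _ => sq_nonneg _] at hs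
  have := hs i hi
  nlinarith

variable {G} {S T : Finset V} {c : ℝ}

lemma card_edges_le (hST : ∀ p ∈ S, (edgesInto G p T : ℝ) ≤ c * #T) :
    ∑ p ∈ S, (#{q ∈ T | G.Adj p q} : ℝ) ≤ c * (#S * #T) :=
  calc _ ≤ ∑ p ∈ S, c * #T := sum_le_sum hST
    _ = _ := by simp; ring

/-- At most half of the pairs of `S × T` are lost to the three non-edge conditions. -/
lemma card_le_two_mul_card_reroutes (hc : c ≤ 1 / 100)
    (hST : ∀ p ∈ S, (edgesInto G p T : ℝ) ≤ c * #T)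
    (hTS : ∀ q ∈ T, (edgesInto G q S : ℝ) ≤ c * #S) {p q : V} (hp : p ∈ S) (hq : q ∈ T) :
    (#S * #T : ℝ) ≤ 2 * #(reroutes G S T p q) := by
  have hW : (#(reroutes G S T p q) : ℝ) = ∑ i ∈ S, ∑ j ∈ T,
      if ¬ G.Adj p j ∧ ¬ G.Adj i q ∧ ¬ G.Adj i j then (1 : ℝ) else 0 := by
    rw [reroutes, card_filter, sum_product]
    push_cast
    rfl
  have h1 : ∑ i ∈ S, ∑ j ∈ T, (if G.Adj p j then (1 : ℝ) else 0) ≤ #S * (c * #T) := by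
    rw [sum_const, nsmul_eq_mul, sum_boole]
    exact mul_le_mul_of_nonneg_left (hST p hp) (by positivity)
  have h2 : ∑ i ∈ S, ∑ j ∈ T, (if G.Adj q i then (1 : ℝ) else 0) ≤ #T * (c * #S) := by
    rw [sum_comm, sum_const, nsmul_eq_mul, sum_boole]
    exact mul_le_mul_of_nonneg_left (hTS q hq) (by positivity)
  have h3 : ∑ i ∈ S, ∑ j ∈ T, (if G.Adj i j then (1 : ℝ) else 0) ≤ c * (#S * #T) := by
    simp only [sum_boole]
    exact card_edges_le hST
  have h4 : (#S * #T : ℝ) ≤ ∑ i ∈ S, ∑ j ∈ T,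
      ((if ¬ G.Adj p j ∧ ¬ G.Adj i q ∧ ¬ G.Adj i j then (1 : ℝ) else 0)
        + (if G.Adj p j then (1 : ℝ) else 0) + (if G.Adj q i then (1 : ℝ) else 0)
        + (if G.Adj i j then (1 : ℝ) else 0)) := by
    calc (#S * #T : ℝ) = ∑ i ∈ S, ∑ j ∈ T, (1 : ℝ) := by simp
      _ ≤ _ := by
        refine sum_le_sum fun i _ => sum_le_sum fun j _ => ?_
        simp only [G.adj_comm i q]
        by_cases a : G.Adj p j <;> by_cases b : G.Adj q i <;> by_cases d : G.Adj i j <;>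
          simp [a, b, d]
  simp only [sum_add_distrib] at h4
  have h5 : 0 ≤ (#S * #T : ℝ) := by positivity
  nlinarith

/-- The mean over the rerouting pairs is at most twice the mean over all pairs. -/
lemma reroutes_mean_le (hc : c ≤ 1 / 100) (hS : S.Nonempty) (hT : T.Nonempty)
    (hST : ∀ p ∈ S, (edgesInto G p T : ℝ) ≤ c * #T)
    (hTS : ∀ q ∈ T, (edgesInto G q S : ℝ) ≤ c * #S) {p q : V} (hp : p ∈ S) (hq : q ∈ T)
    (f : V × V → ℝ) (hf : ∀ x, 0 ≤ f x) :
    (#(reroutes G S T p q) : ℝ)⁻¹ * ∑ x ∈ reroutes G S T p q, f x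
      ≤ 2 * ((#S * #T : ℝ)⁻¹ * ∑ x ∈ S ×ˢ T, f x) := by
  have hcard := card_le_two_mul_card_reroutes hc hST hTS hp hq
  have hpos : (0 : ℝ) < #S * #T := by
    have := hS.card_pos; have := hT.card_pos; positivity
  have hsum : ∑ x ∈ reroutes G S T p q, f x ≤ ∑ x ∈ S ×ˢ T, f x :=
    sum_le_sum_of_subset_of_nonneg (filter_subset _ _) fun x _ _ => hf x
  have h0 : 0 ≤ ∑ x ∈ S ×ˢ T, f x := sum_nonneg fun x _ => hf x
  have hinv : (#(reroutes G S T p q) : ℝ)⁻¹ ≤ 2 * (#S * #T : ℝ)⁻¹ := by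
    rw [inv_le_comm₀ (by linarith) (by positivity), mul_inv, inv_inv]
    linarith
  calc _ ≤ (2 * (#S * #T : ℝ)⁻¹) * ∑ x ∈ S ×ˢ T, f x :=
        mul_le_mul hinv hsum (sum_nonneg fun x _ => hf x) (by positivity)
    _ = _ := by ring

lemma sum_edges_left_le {f : V → ℝ} (hf : ∀ p, 0 ≤ f p)
    (hST : ∀ p ∈ S, (edgesInto G p T : ℝ) ≤ c * #T) :
    ∑ p ∈ S, ∑ _q ∈ T with G.Adj p _q, f p ≤ c * #T * ∑ p ∈ S, f p := by
  rw [mul_sum]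
  refine sum_le_sum fun p hp => ?_
  rw [sum_const, nsmul_eq_mul]
  exact mul_le_mul_of_nonneg_right (hST p hp) (hf p)

lemma sum_edges_right_le {f : V → ℝ} (hf : ∀ q, 0 ≤ f q)
    (hTS : ∀ q ∈ T, (edgesInto G q S : ℝ) ≤ c * #S) :
    ∑ p ∈ S, ∑ q ∈ T with G.Adj p q, f q ≤ c * #S * ∑ q ∈ T, f q := by
  calc _ = ∑ q ∈ T, ∑ p ∈ S with G.Adj q p, f q := by
        simp only [sum_filter]
        rw [sum_comm]
        simp only [G.adj_comm]
    _ ≤ _ := sum_edges_left_le hf hTS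

/-- On a rank-one matrix the double differences factor, so the correction only sees the
deviations of `y` from its means, and sparsity makes it small against the variances. -/
lemma abs_rerouting_le (hc : c ≤ 1 / 100) (hS : S.Nonempty) (hT : T.Nonempty)
    (hST : ∀ p ∈ S, (edgesInto G p T : ℝ) ≤ c * #T)
    (hTS : ∀ q ∈ T, (edgesInto G q S : ℝ) ≤ c * #S) (y : V → ℝ) :
    |rerouting G S T (Matrix.vecMulVec y y)|
      ≤ 3 * c * (varOn S y + varOn T y) * (#S * #T) := by
  set z : V → ℝ := fun i => (y i - meanOn S y) ^ 2 with hz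
  set w : V → ℝ := fun j => (y j - meanOn T y) ^ 2 with hw
  have hz0 : ∀ i, 0 ≤ z i := fun i => sq_nonneg _
  have hw0 : ∀ i, 0 ≤ w i := fun i => sq_nonneg _
  have hS0 : (#S : ℝ) ≠ 0 := by simpa using hS.ne_empty
  have hT0 : (#T : ℝ) ≠ 0 := by simpa using hT.ne_empty
  have hzs : ∑ i ∈ S, z i = #S * varOn S y := (card_mul_varOn hS y).symm
  have hws : ∑ i ∈ T, w i = #T * varOn T y := (card_mul_varOn hT y).symm
  have hterm : ∀ p ∈ S, ∀ q ∈ T, |(#(reroutes G S T p q) : ℝ)⁻¹ * ∑ x ∈ reroutes G S T p q,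
      (y p * y q - y p * y x.2 - y x.1 * y q + y x.1 * y x.2)|
      ≤ z p + w q + 2 * (varOn S y + varOn T y) := by
    intro p hp q hq
    have hW : (0 : ℝ) < #(reroutes G S T p q) := by
      have h1 := card_le_two_mul_card_reroutes hc hST hTS hp hq
      have h2 : (0 : ℝ) < #S * #T := by positivity
      linarith
    have hmean := reroutes_mean_le hc hS hT hST hTS hp hq (fun x => z x.1 + w x.2)
      (fun x => add_nonneg (hz0 _) (hw0 _))
    have hall : (#S * #T : ℝ)⁻¹ * ∑ x ∈ S ×ˢ T, (z x.1 + w x.2) = varOn S y + varOn T y := by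
      rw [sum_product]
      simp only [sum_add_distrib, sum_const, nsmul_eq_mul, ← mul_sum]
      rw [hzs, hws]
      field_simp
    rw [hall] at hmean
    rw [abs_mul, abs_of_pos (inv_pos.2 hW)]
    calc _ ≤ (#(reroutes G S T p q) : ℝ)⁻¹ * ∑ x ∈ reroutes G S T p q,
          (z p + w q + (z x.1 + w x.2)) := by
          refine mul_le_mul_of_nonneg_left ?_ (inv_nonneg.2 hW.le)
          refine (abs_sum_le_sum_abs _ _).trans (sum_le_sum fun x _ => ?_)
          -- the double difference is `(y p - y i) * (y q - y j)`, and `y` may be centred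
          simp only [hz, hw]
          rw [abs_le]
          constructor
          · nlinarith [sq_nonneg ((y p - y x.1) + (y q - y x.2)),
              sq_nonneg ((y p - meanOn S y) + (y x.1 - meanOn S y)),
              sq_nonneg ((y q - meanOn T y) + (y x.2 - meanOn T y))]
          · nlinarith [sq_nonneg ((y p - y x.1) - (y q - y x.2)),
              sq_nonneg ((y p - meanOn S y) + (y x.1 - meanOn S y)),
              sq_nonneg ((y q - meanOn T y) + (y x.2 - meanOn T y))]
      _ = z p + w q + (#(reroutes G S T p q) : ℝ)⁻¹ * ∑ x ∈ reroutes G S T p q,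
          (z x.1 + w x.2) := by
          rw [sum_add_distrib, sum_const, nsmul_eq_mul, mul_add, inv_mul_cancel_left₀ hW.ne']
      _ ≤ _ := by linarith
  rw [rerouting_apply]
  simp only [Matrix.vecMulVec_apply]
  calc _ ≤ ∑ p ∈ S, ∑ q ∈ T with G.Adj p q, (z p + w q + 2 * (varOn S y + varOn T y)) := by
        refine (abs_sum_le_sum_abs _ _).trans (sum_le_sum fun p hp => ?_)
        exact (abs_sum_le_sum_abs _ _).trans
          (sum_le_sum fun q hq => hterm p hp q (mem_of_mem_filter q hq))
    _ = ∑ p ∈ S, ∑ q ∈ T with G.Adj p q, z p + ∑ p ∈ S, ∑ q ∈ T with G.Adj p q, w q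
        + (∑ p ∈ S, (#{q ∈ T | G.Adj p q} : ℝ)) * (2 * (varOn S y + varOn T y)) := by
        simp only [sum_add_distrib, sum_const, nsmul_eq_mul, sum_mul]
    _ ≤ c * #T * ∑ p ∈ S, z p + c * #S * ∑ q ∈ T, w q
        + c * (#S * #T) * (2 * (varOn S y + varOn T y)) := by
        have := varOn_nonneg S y
        have := varOn_nonneg T y
        exact add_le_add (add_le_add (sum_edges_left_le hz0 hST) (sum_edges_right_le hw0 hTS))
          (mul_le_mul_of_nonneg_right (card_edges_le hST) (by positivity))
    _ = _ := by rw [hzs, hws]; ring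

lemma blockMean_vecMulVec_ge (hc : c ≤ 1 / 100) (hS : S.Nonempty) (hT : T.Nonempty)
    (hST : ∀ p ∈ S, (edgesInto G p T : ℝ) ≤ c * #T)
    (hTS : ∀ q ∈ T, (edgesInto G q S : ℝ) ≤ c * #S) (y : V → ℝ) :
    meanOn S y * meanOn T y - 3 * c * (varOn S y + varOn T y)
      ≤ blockMean G S T (Matrix.vecMulVec y y) := by
  have hpos : (0 : ℝ) < #S * #T := by
    have := hS.card_pos; have := hT.card_pos; positivity
  have h := (le_abs_self _).trans (abs_rerouting_le hc hS hT hST hTS y)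
  have hmul : (#S * #T : ℝ)⁻¹ * ∑ p ∈ S, ∑ q ∈ T, y p * y q = meanOn S y * meanOn T y := by
    rw [meanOn, meanOn, ← sum_mul_sum, mul_inv]; ring
  have h' := mul_le_mul_of_nonneg_left h (inv_nonneg.2 hpos.le)
  rw [mul_comm (3 * c * _), inv_mul_cancel_left₀ hpos.ne'] at h'
  rw [blockMean_apply, mul_sub]
  simp only [Matrix.vecMulVec_apply]
  linarith

lemma blockMean_allOnes (hS : S.Nonempty) (hT : T.Nonempty) :
    blockMean G S T (allOnes V) = 1 := by
  have hS0 : (#S : ℝ) ≠ 0 := by simpa using hS.ne_empty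
  have hT0 : (#T : ℝ) ≠ 0 := by simpa using hT.ne_empty
  simp [blockMean_apply, rerouting_apply, allOnes]
  field_simp

/-- A matrix supported on the edges is not seen by the corrected mean. -/
lemma blockMean_eq_zero (hc : c ≤ 1 / 100)
    (hST : ∀ p ∈ S, (edgesInto G p T : ℝ) ≤ c * #T)
    (hTS : ∀ q ∈ T, (edgesInto G q S : ℝ) ≤ c * #S) {M : Matrix V V ℝ}
    (hM : ∀ i ∈ S, ∀ j ∈ T, ¬ G.Adj i j → M i j = 0) : blockMean G S T M = 0 := by
  rw [blockMean_apply, rerouting_apply]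
  refine mul_eq_zero_of_right _ (sub_eq_zero.2 (sum_congr rfl fun p hp => ?_))
  rw [sum_filter]
  refine sum_congr rfl fun q hq => ?_
  split_ifs with hadj
  · have hW : (#(reroutes G S T p q) : ℝ) ≠ 0 := by
      have h1 := card_le_two_mul_card_reroutes hc hST hTS hp hq
      have h2 : (0 : ℝ) < #S * #T := by
        have := card_pos.2 ⟨p, hp⟩; have := card_pos.2 ⟨q, hq⟩; positivity
      intro h; linarith
    have hsum : ∀ x ∈ reroutes G S T p q, M p q - M p x.2 - M x.1 q + M x.1 x.2 = M p q := by
      intro x hx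
      simp only [reroutes, mem_filter, mem_product] at hx
      obtain ⟨⟨hi, hj⟩, h1, h2, h3⟩ := hx
      rw [hM p hp _ hj h1, hM _ hi q hq h2, hM _ hi _ hj h3]
      ring
    rw [sum_congr rfl hsum, sum_const, nsmul_eq_mul, inv_mul_cancel_left₀ hW]
  · exact hM p hp q hq hadj

end Block

/-! ### The dual certificate -/

section Certificate

variable {V : Type*} {G : SimpleGraph V} [DecidableRel G.Adj] {k : ℕ} {C : Fin k → Finset V}
  {c : ℝ}

lemma dualPairing_apply (M : Matrix V V ℝ) :
    dualPairing G C M = ∑ l, ∑ m, if l = m then (#(C l) : ℝ)⁻¹ * ∑ i ∈ C l, M i i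
      else blockMean G (C l) (C m) M := by
  simp only [dualPairing, LinearMap.sum_apply]
  refine sum_congr rfl fun l _ => sum_congr rfl fun m _ => ?_
  split_ifs <;> simp [LinearMap.sum_apply]

lemma IsSCC.edgesInto_le (hC : IsCliqueCover G C) (h : IsSCC G C c) {l m : Fin k} (hlm : l ≠ m) :
    ∀ p ∈ C l, (edgesInto G p (C m) : ℝ) ≤ c * #(C m) :=
  fun p hp => h p m (disjoint_left.1 (hC.disjoint l m hlm) hp)

lemma dualPairing_one [DecidableEq V] (hC : IsCliqueCover G C) (h : IsSCC G C c)
    (hc : c ≤ 1 / 100) : dualPairing G C 1 = k := by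
  rw [dualPairing_apply]
  have : ∀ l m : Fin k, (if l = m then (#(C l) : ℝ)⁻¹ * ∑ i ∈ C l, (1 : Matrix V V ℝ) i i
      else blockMean G (C l) (C m) 1) = if l = m then 1 else 0 := by
    intro l m
    split_ifs with hlm
    · have : (#(C l) : ℝ) ≠ 0 := by simpa using (hC.nonempty l).ne_empty
      simp [this]
    · refine blockMean_eq_zero hc (h.edgesInto_le hC hlm) (h.edgesInto_le hC (Ne.symm hlm)) ?_
      intro i hi j hj _
      refine Matrix.one_apply_ne fun hij => ?_
      exact disjoint_left.1 (hC.disjoint l m hlm) hi (hij ▸ hj)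
  simp_rw [this]
  simp

lemma dualPairing_allOnes (hC : IsCliqueCover G C) : dualPairing G C (allOnes V) = k ^ 2 := by
  rw [dualPairing_apply]
  have : ∀ l m : Fin k, (if l = m then (#(C l) : ℝ)⁻¹ * ∑ i ∈ C l, allOnes V i i
      else blockMean G (C l) (C m) (allOnes V)) = 1 := by
    intro l m
    have h0 : (#(C l) : ℝ) ≠ 0 := by simpa using (hC.nonempty l).ne_empty
    split_ifs with hlm
    · simp [allOnes, h0]
    · exact blockMean_allOnes (hC.nonempty l) (hC.nonempty m)
  simp_rw [this]
  simp [sq]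

lemma dualPairing_eq_zero (hC : IsCliqueCover G C) (h : IsSCC G C c) (hc : c ≤ 1 / 100)
    {A : Matrix V V ℝ} (hA0 : ∀ i, A i i = 0) (hA : ∀ i j, ¬ G.Adj i j → A i j = 0) :
    dualPairing G C A = 0 := by
  rw [dualPairing_apply]
  refine sum_eq_zero fun l _ => sum_eq_zero fun m _ => ?_
  split_ifs with hlm
  · simp [hA0]
  · exact blockMean_eq_zero hc (h.edgesInto_le hC hlm) (h.edgesInto_le hC (Ne.symm hlm))
      fun i _ j _ => hA i j

/-- The dual point is positive semidefinite, and its quadratic form vanishes only at the vectors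
that are constant on each clique with constants summing to zero. -/
lemma dualPairing_vecMulVec_ge (hC : IsCliqueCover G C) (h : IsSCC G C c) (hc0 : 0 ≤ c)
    (hc : c ≤ 1 / 100) (hck : c * k ≤ 1 / 20) (y : V → ℝ) :
    (∑ l, meanOn (C l) y) ^ 2 + (1 / 2) * ∑ l, varOn (C l) y
      ≤ dualPairing G C (Matrix.vecMulVec y y) := by
  have hv : ∀ l, 0 ≤ varOn (C l) y := fun l => varOn_nonneg _ _
  have hterm : ∀ l m : Fin k, meanOn (C l) y * meanOn (C m) y
      + (if l = m then varOn (C l) y else 0) - 3 * c * (varOn (C l) y + varOn (C m) y)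
      ≤ if l = m then (#(C l) : ℝ)⁻¹ * ∑ i ∈ C l, Matrix.vecMulVec y y i i
        else blockMean G (C l) (C m) (Matrix.vecMulVec y y) := by
    intro l m
    split_ifs with hlm
    · subst hlm
      simp only [Matrix.vecMulVec_apply]
      rw [mean_sq_eq (hC.nonempty l)]
      have := mul_nonneg hc0 (hv l)
      nlinarith
    · have := blockMean_vecMulVec_ge hc (hC.nonempty l) (hC.nonempty m)
        (h.edgesInto_le hC hlm) (h.edgesInto_le hC (Ne.symm hlm)) y
      linarith
  have hsum := sum_le_sum fun l (_ : l ∈ univ) => sum_le_sum fun m (_ : m ∈ univ) => hterm l m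
  rw [← dualPairing_apply] at hsum
  simp only [sum_sub_distrib, sum_add_distrib, ← mul_sum, ← sum_mul, sum_ite_eq, mem_univ,
    if_true, sum_const, card_univ, Fintype.card_fin, nsmul_eq_mul] at hsum
  have := mul_le_mul_of_nonneg_right hck (sum_nonneg fun l (_ : l ∈ univ) => hv l)
  have := sum_nonneg fun l (_ : l ∈ univ) => hv l
  linarith

/-- Evaluating the dual pairing on a slack matrix gives weak duality. -/
lemma dualPairing_slack [DecidableEq V] (hC : IsCliqueCover G C) (h : IsSCC G C c)
    (hc : c ≤ 1 / 100) {p : ℝ × Matrix V V ℝ} (hp : p ∈ thetaFeasible G) :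
    dualPairing G C (slack p) = k * (p.1 - k) := by
  rw [slack, map_sub, map_add, map_smul, dualPairing_one hC h hc,
    dualPairing_eq_zero hC h hc hp.2.1 hp.2.2, dualPairing_allOnes hC, smul_eq_mul]
  ring

/-- Complementary slackness: the objective of a feasible point is at least `k`, and the slack
matrix of a feasible point of value `k` depends only on the cliques of its two indices. -/
lemma le_objective_and_slack_eq [Fintype V] [DecidableEq V] (hC : IsCliqueCover G C)
    (h : IsSCC G C c) (hk : 0 < k) (hc0 : 0 ≤ c) (hc : c ≤ 1 / 100) (hck : c * k ≤ 1 / 20)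
    {p : ℝ × Matrix V V ℝ} (hp : p ∈ thetaFeasible G) :
    (k : ℝ) ≤ p.1 ∧ (p.1 = k → ∀ l m, ∀ i ∈ C l, ∀ i' ∈ C l, ∀ j ∈ C m, ∀ j' ∈ C m,
      slack p i j = slack p i' j') := by
  obtain ⟨n, Y, hY⟩ := Matrix.posSemidef_iff_eq_sum_vecMulVec.mp hp.1
  have hsum : slack p = ∑ r, Matrix.vecMulVec (Y r) (Y r) := by simpa using hY
  have hval : ∑ r, dualPairing G C (Matrix.vecMulVec (Y r) (Y r)) = k * (p.1 - k) := by
    rw [← map_sum, ← hsum, dualPairing_slack hC h hc hp]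
  have hge := fun r => dualPairing_vecMulVec_ge hC h hc0 hc hck (Y r)
  have hvar : ∀ r l, 0 ≤ varOn (C l) (Y r) := fun r l => varOn_nonneg _ _
  have hvars : ∀ r, 0 ≤ ∑ l, varOn (C l) (Y r) := fun r => sum_nonneg fun l _ => hvar r l
  have hnonneg : ∀ r, 0 ≤ dualPairing G C (Matrix.vecMulVec (Y r) (Y r)) := fun r =>
    le_trans (add_nonneg (sq_nonneg _) (mul_nonneg (by norm_num) (hvars r))) (hge r)
  have hk' : (0 : ℝ) < k := by exact_mod_cast hk
  refine ⟨?_, fun ht l m i hi i' hi' j hj j' hj' => ?_⟩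
  · have : 0 ≤ (k : ℝ) * (p.1 - k) := hval ▸ sum_nonneg fun r _ => hnonneg r
    linarith [nonneg_of_mul_nonneg_right this hk']
  · rw [ht, sub_self, mul_zero, sum_eq_zero_iff_of_nonneg fun r _ => hnonneg r] at hval
    have hzero : ∀ r l, varOn (C l) (Y r) = 0 := by
      intro r l
      have h1 := hge r
      rw [hval r (mem_univ r)] at h1
      have h2 := single_le_sum (fun l _ => hvar r l) (mem_univ l)
      nlinarith [hvar r l, sq_nonneg (∑ l, meanOn (C l) (Y r))]
    have hconst : ∀ r l, ∀ i ∈ C l, Y r i = meanOn (C l) (Y r) := fun r l i hi =>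
      eq_meanOn_of_varOn_eq_zero (hzero r l) hi
    rw [hsum, Matrix.sum_apply, Matrix.sum_apply]
    refine sum_congr rfl fun r _ => ?_
    rw [Matrix.vecMulVec_apply, Matrix.vecMulVec_apply, hconst r l i hi, hconst r l i' hi',
      hconst r m j hj, hconst r m j' hj']

end Certificate

/-! ### The primal solution -/

section Primal

variable {V : Type*} [DecidableEq V] {G : SimpleGraph V} {k : ℕ} {C : Fin k → Finset V}

lemma Astar_apply_of_mem (hC : IsCliqueCover G C) {i : V} {l : Fin k} (hi : i ∈ C l) (j : V) :
    Astar C i j = (if j ∈ C l then (k : ℝ) else 0) - if i = j then (k : ℝ) else 0 := by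
  have hmem : ∀ m, i ∈ C m ↔ m = l := fun m =>
    ⟨fun hm => by_contra fun hne => disjoint_left.1 (hC.disjoint m l hne) hm hi, fun e => e ▸ hi⟩
  simp [Astar, Matrix.sum_apply, Matrix.vecMulVec_apply, indVec, hmem, Matrix.one_apply]
  rw [sum_eq_single l] <;> simp +contextual

lemma Xstar_eq_slack : Xstar C = slack ((k : ℝ), Astar C) := rfl

lemma Xstar_posSemidef [Fintype V] (hC : IsCliqueCover G C) : (Xstar C).PosSemidef := by
  have hX : Xstar C = (k : ℝ) • ∑ l, Matrix.vecMulVec (indVec (C l)) (indVec (C l))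
      - Matrix.vecMulVec (∑ l, indVec (C l)) (∑ l, indVec (C l)) := by
    have h1 : ∀ v, (∑ l, indVec (C l)) v = 1 := by
      intro v
      obtain ⟨l, hl⟩ := hC.cover v
      have hmem : ∀ m, v ∈ C m ↔ m = l := fun m =>
        ⟨fun hm => by_contra fun hne => disjoint_left.1 (hC.disjoint m l hne) hm hl,
          fun e => e ▸ hl⟩
      simp [indVec, hmem]
    ext i j
    simp [Xstar, Astar, allOnes, Matrix.vecMulVec_apply, h1, -Finset.sum_apply, smul_sum]
  refine Matrix.PosSemidef.of_dotProduct_mulVec_nonneg ?_ fun x => ?_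
  · rw [hX]
    ext i j
    simp [Matrix.sum_apply, Matrix.vecMulVec_apply, mul_comm]
  · rw [hX]
    -- Cauchy–Schwarz for the sums of `x` over the `k` cliques
    have hcs := sq_sum_le_card_mul_sum_sq (s := univ) (f := fun l => indVec (C l) ⬝ᵥ x)
    rw [card_univ, Fintype.card_fin] at hcs
    have hq : ∀ u : V → ℝ, x ⬝ᵥ Matrix.vecMulVec u u *ᵥ x = (u ⬝ᵥ x) ^ 2 := by
      intro u
      rw [Matrix.vecMulVec_mulVec, sq, dotProduct_comm u x]
      simp
    rw [star_trivial, Matrix.sub_mulVec, dotProduct_sub, Matrix.smul_mulVec, dotProduct_smul,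
      Matrix.sum_mulVec, dotProduct_sum, hq, sum_dotProduct]
    simp only [hq, smul_eq_mul]
    linarith

lemma Astar_mem_thetaFeasible [Fintype V] (hC : IsCliqueCover G C) :
    ((k : ℝ), Astar C) ∈ thetaFeasible G := by
  refine ⟨Xstar_posSemidef hC, fun i => ?_, fun i j hij => ?_⟩
  · obtain ⟨l, hl⟩ := hC.cover i
    simp [Astar_apply_of_mem hC hl, hl]
  · obtain ⟨l, hl⟩ := hC.cover i
    by_cases e : i = j
    · subst e; simp [Astar_apply_of_mem hC hl, hl]
    · have : j ∉ C l := fun hj => hij (hC.isClique l hl hj e)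
      simp [Astar_apply_of_mem hC hl, this, e]

/-- A feasible point of value `k` whose slack matrix is constant on blocks is the clique solution:
the diagonal fixes the diagonal blocks, and every other block has a non-edge, as the graph is
sparse between cliques, so that it is constantly `-1`. -/
lemma eq_Astar [DecidableRel G.Adj] {c : ℝ} (hC : IsCliqueCover G C) (h : IsSCC G C c)
    (hc : c < 1) {p : ℝ × Matrix V V ℝ} (hp : p ∈ thetaFeasible G) (ht : p.1 = k)
    (hconst : ∀ l m, ∀ i ∈ C l, ∀ i' ∈ C l, ∀ j ∈ C m, ∀ j' ∈ C m,
      slack p i j = slack p i' j') : p = ((k : ℝ), Astar C) := by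
  have hsl : ∀ i j, slack p i j = (if i = j then (k : ℝ) else 0) + p.2 i j - 1 := by
    intro i j
    simp [slack, allOnes, Matrix.one_apply, ht]
  refine Prod.ext ht ?_
  ext i j
  obtain ⟨l, hl⟩ := hC.cover i
  refine Eq.trans ?_ (Astar_apply_of_mem hC hl j).symm
  by_cases hj : j ∈ C l
  · have h1 := hconst l l i hl i hl j hj i hl
    rw [hsl, hsl, hp.2.1 i] at h1
    simp only [hj, if_true] at h1 ⊢
    linarith
  · obtain ⟨m, hm⟩ := hC.cover j
    have hlm : l ≠ m := by rintro rfl; exact hj hm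
    obtain ⟨j', hj', hadj⟩ : ∃ j' ∈ C m, ¬ G.Adj i j' := by
      by_contra! hall
      have h1 := h.edgesInto_le hC hlm i hl
      rw [edgesInto, filter_true_of_mem hall] at h1
      have h2 : (0 : ℝ) < #(C m) := by exact_mod_cast card_pos.2 ⟨j, hm⟩
      nlinarith
    have hij : i ≠ j := fun e => hj (e ▸ hl)
    have hij' : i ≠ j' := fun e => disjoint_left.1 (hC.disjoint l m hlm) hl (e ▸ hj')
    have h1 := hconst l m i hl i hl j hm j' hj'
    rw [hsl, hsl, hp.2.2 i j' hadj] at h1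
    simp only [hij, hij', hj, if_false] at h1 ⊢
    linarith

end Primal

/-! ### Optimality and uniqueness -/

/-- The smallest of `k` positive numbers is at most their mean. -/
lemma iInf_div_sum_le {k : ℕ} (hk : 0 < k) {f : Fin k → ℝ} (hf : ∀ l, 0 < f l) :
    0 < (⨅ l, f l) / ∑ l, f l ∧ ((⨅ l, f l) / ∑ l, f l) * k ≤ 1 := by
  have : Nonempty (Fin k) := ⟨⟨0, hk⟩⟩
  have hsum : 0 < ∑ l, f l := sum_pos (fun l _ => hf l) univ_nonempty
  obtain ⟨l₀, hl₀⟩ := exists_eq_ciInf_of_finite (f := f)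
  refine ⟨div_pos (hl₀ ▸ hf l₀) hsum, ?_⟩
  rw [div_mul_eq_mul_div, div_le_one hsum]
  calc (⨅ l, f l) * k = ∑ _l : Fin k, ⨅ l, f l := by simp [mul_comm]
    _ ≤ _ := sum_le_sum fun l _ => ciInf_le (Set.finite_range f).bddBelow l

theorem mainTheorem2 {V : Type*} [Fintype V] [DecidableEq V] [Nonempty V]
    (G : SimpleGraph V) [DecidableRel G.Adj] {k : ℕ} (C : Fin k → Finset V)
    (hC : IsCliqueCover G C) (c : ℝ) (hscc : IsSCC G C c)
    (hc : c < min
      ((1 / 4) * ((⨅ l, 1 / ((C l).card : ℝ)) / (∑ l, 1 / ((C l).card : ℝ))) ^ 2)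
      (1 / 100)) :
    thetaOptimal G = {((k : ℝ), Astar C)} ∧ slack '' thetaOptimal G = {Xstar C} := by
  obtain ⟨l₀, -⟩ := hC.cover (Classical.arbitrary V)
  have hk : 0 < k := l₀.pos
  obtain ⟨hr0, hr1⟩ := iInf_div_sum_le hk (f := fun l => 1 / ((C l).card : ℝ))
    fun l => by have := (hC.nonempty l).card_pos; positivity
  set r := (⨅ l, 1 / ((C l).card : ℝ)) / (∑ l, 1 / ((C l).card : ℝ)) with hr
  rw [lt_min_iff] at hc
  -- for a single clique `c` may be negative
  have hscc' : IsSCC G C (max c 0) := fun v l hv =>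
    (hscc v l hv).trans (mul_le_mul_of_nonneg_right (le_max_left _ _) (by positivity))
  have hc0 : 0 ≤ max c 0 := le_max_right _ _
  have hc1 : max c 0 ≤ 1 / 100 := max_le hc.2.le (by norm_num)
  have hc2 : max c 0 ≤ 1 / 4 * r ^ 2 := max_le hc.1.le (by positivity)
  have hck : max c 0 * k ≤ 1 / 20 := by
    generalize max c 0 = d at *
    -- `(d * k) ^ 2 = d * (d * k ^ 2) ≤ 1 / 100 * (1 / 4)`
    have h1 : d * (k : ℝ) ^ 2 ≤ 1 / 4 := by
      have h2 : (r * k) ^ 2 ≤ 1 := pow_le_one₀ (by positivity) hr1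
      nlinarith [mul_le_mul_of_nonneg_right hc2 (sq_nonneg (k : ℝ))]
    have h2 : (d * k) ^ 2 ≤ (1 / 20) ^ 2 := by
      nlinarith [mul_le_mul hc1 h1 (by positivity) (by norm_num)]
    exact le_of_sq_le_sq h2 (by norm_num)
  have key := fun {p : ℝ × Matrix V V ℝ} (hp : p ∈ thetaFeasible G) =>
    le_objective_and_slack_eq hC hscc' hk hc0 hc1 hck hp
  have hopt : thetaOptimal G = {((k : ℝ), Astar C)} := by
    ext p
    simp only [Set.mem_singleton_iff]
    constructor
    · rintro ⟨hp, hmin⟩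
      have ht : p.1 = k := le_antisymm (hmin _ (Astar_mem_thetaFeasible hC)) (key hp).1
      exact eq_Astar hC hscc' (by linarith) hp ht ((key hp).2 ht)
    · rintro rfl
      exact ⟨Astar_mem_thetaFeasible hC, fun q hq => (key hq).1⟩
  exact ⟨hopt, by rw [hopt, Set.image_singleton, Xstar_eq_slack]⟩
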